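/- Let $\mathcal H$ be a complex Hilbert space with an orthonormal basis $(|n\rangle)_{n\ge 0}$, and for $X$ in the Borel $\sigma$-algebra $\mathcal B([0,2\pi))$ let $$E_{\rm can}(X)=\sum_{n,m=0}^{\infty}\frac1{2\pi}\int_X e^{i(n-m)x}\,dx\;|n\rangle\langle m|$$ be the canonical phase, i.e. the bounded operator on $\mathcal H$ with matrix elements $\langle n|E_{\rm can}(X)|m\rangle=\frac1{2\pi}\int_X e^{i(n-m)x}\,dx$. Then the number observable $N=\sum_n n|n\rangle\langle n|$ and $E_{\rm can}$ are probabilistically complementary: for every unit vector $\varphi\in\mathcal H$, every nonempty finite set $\{n_1,\dots,n_k\}\subset\mathbb N$ (with distinct $n_i$), and every $X\in\mathcal B([0,2\pi))$ with $O\neq E_{\rm can}(X)\neq I$, $$\sum_{i=1}^k|\langle\varphi|n_i\rangle|^2=1\ \text{ implies }\ 0<\langle\varphi|E_{\rm can}(X)\varphi\rangle<1,$$ and $$\langle\varphi|E_{\rm can}(X)\varphi\rangle=1\ \text{ implies }\ 0<\sum_{i=1}^k|\langle\varphi|n_i\rangle|^2<1.$$ -/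

import Mathlib

open MeasureTheory
open scoped ComplexOrder

/-- The phase interval `[0, 2π)`. Its measurable subsets are the Borel subsets of `[0, 2π)`, and
its `volume` is the Lebesgue measure. -/
abbrev PhaseInterval : Type := Set.Ico (0 : ℝ) (2 * Real.pi)

namespace NumberPhase

/-- Lebesgue measure on `[0, 2π)`. -/
noncomputable instance instMeasureSpacePhase : MeasureSpace PhaseInterval :=
  Measure.Subtype.measureSpace

/-- The number `(1 / 2π) ∫_X e^{i (n - m) x} dx`. -/
noncomputable def phaseEntry (X : Set PhaseInterval) (n m : ℕ) : ℂ :=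
  (1 / (2 * (Real.pi : ℂ))) *
    ∫ x in X, Complex.exp (Complex.I * ((n : ℂ) - (m : ℂ)) * ((x : ℝ) : ℂ))

section Construction

instance instIsFiniteMeasurePhase : IsFiniteMeasure (volume : Measure PhaseInterval) := by
  refine ⟨?_⟩
  rw [Measure.Subtype.volume_univ measurableSet_Ico.nullMeasurableSet, Real.volume_Ico]
  exact ENNReal.ofReal_lt_top

/-- The normalised exponential `x ↦ e^{-i n x} / √(2π)`. -/
noncomputable def phaseWave (n : ℕ) (x : PhaseInterval) : ℂ :=
  ((Real.sqrt (2 * Real.pi) : ℝ) : ℂ)⁻¹ * Complex.exp (-(Complex.I * (n : ℂ) * ((x : ℝ) : ℂ)))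

theorem memLp_phaseWave (n : ℕ) : MemLp (phaseWave n) 2 (volume : Measure PhaseInterval) := by
  refine MemLp.of_bound (C := ‖((Real.sqrt (2 * Real.pi) : ℝ) : ℂ)⁻¹‖) ?_ ?_
  · refine Continuous.aestronglyMeasurable ?_
    unfold phaseWave
    fun_prop
  · refine Filter.Eventually.of_forall fun x => ?_
    rw [phaseWave, norm_mul, Complex.norm_exp]
    simp

theorem star_phaseWave_mul (n m : ℕ) (x : PhaseInterval) :
    phaseWave m x * (starRingEnd ℂ) (phaseWave n x) = (1 / (2 * (Real.pi : ℂ))) *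
      Complex.exp (Complex.I * ((n : ℂ) - (m : ℂ)) * ((x : ℝ) : ℂ)) := by
  have h : ((Real.sqrt (2 * Real.pi) : ℝ) : ℂ) * ((Real.sqrt (2 * Real.pi) : ℝ) : ℂ)
      = 2 * (Real.pi : ℂ) := by
    rw [← Complex.ofReal_mul, Real.mul_self_sqrt (by positivity)]
    push_cast
    ring
  have h2 : Complex.exp (Complex.I * ((n : ℂ) - (m : ℂ)) * ((x : ℝ) : ℂ))
      = Complex.exp (-(Complex.I * (m : ℂ) * ((x : ℝ) : ℂ))) *
        Complex.exp (Complex.I * (n : ℂ) * ((x : ℝ) : ℂ)) := by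
    rw [← Complex.exp_add]
    congr 1
    ring
  have h3 : (starRingEnd ℂ) (phaseWave n x) = ((Real.sqrt (2 * Real.pi) : ℝ) : ℂ)⁻¹ *
      Complex.exp (Complex.I * (n : ℂ) * ((x : ℝ) : ℂ)) := by
    simp [phaseWave, ← Complex.exp_conj]
  rw [h3, h2, phaseWave, ← h, one_div, mul_inv]
  ring

theorem phaseEntry_univ (n m : ℕ) : phaseEntry Set.univ n m = if n = m then 1 else 0 := by
  have hpi : (Real.pi : ℂ) ≠ 0 := by exact_mod_cast Real.pi_ne_zero
  have key : (∫ x : PhaseInterval, Complex.exp (Complex.I * ((n : ℂ) - (m : ℂ)) * ((x : ℝ) : ℂ)))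
      = ∫ x in (0 : ℝ)..(2 * Real.pi),
          Complex.exp (Complex.I * ((n : ℂ) - (m : ℂ)) * (x : ℂ)) := by
    rw [intervalIntegral.integral_of_le (by positivity), ← integral_Ico_eq_integral_Ioc]
    exact integral_subtype measurableSet_Ico
      (fun x : ℝ => Complex.exp (Complex.I * ((n : ℂ) - (m : ℂ)) * (x : ℂ)))
  rw [phaseEntry, Measure.restrict_univ, key]
  split_ifs with h
  · subst h
    simp
    field_simp
  · have hc : Complex.I * ((n : ℂ) - (m : ℂ)) ≠ 0 := by
      refine mul_ne_zero Complex.I_ne_zero (sub_ne_zero.2 ?_)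
      exact_mod_cast h
    rw [integral_exp_mul_complex hc]
    have : Complex.exp (Complex.I * ((n : ℂ) - (m : ℂ)) * ((2 * Real.pi : ℝ) : ℂ)) = 1 := by
      rw [Complex.exp_eq_one_iff]
      exact ⟨(n : ℤ) - m, by push_cast; ring⟩
    rw [this]
    simp

theorem inner_phaseWave (μ : Measure PhaseInterval) (n m : ℕ)
    (hn : MemLp (phaseWave n) 2 μ) (hm : MemLp (phaseWave m) 2 μ) :
    inner ℂ (hn.toLp (phaseWave n)) (hm.toLp (phaseWave m)) = (1 / (2 * (Real.pi : ℂ))) *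
      ∫ x, Complex.exp (Complex.I * ((n : ℂ) - (m : ℂ)) * ((x : ℝ) : ℂ)) ∂μ := by
  rw [L2.inner_def, ← integral_const_mul]
  refine integral_congr_ae ?_
  filter_upwards [hn.coeFn_toLp, hm.coeFn_toLp] with x h1 h2
  rw [h1, h2, ← star_phaseWave_mul]
  simp

theorem orthonormal_phaseWave :
    Orthonormal ℂ (fun n : ℕ => (memLp_phaseWave n).toLp (phaseWave n)) := by
  rw [orthonormal_iff_ite]
  intro n m
  rw [inner_phaseWave, ← phaseEntry_univ, phaseEntry, Measure.restrict_univ]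

variable {H : Type*} [NormedAddCommGroup H] [InnerProductSpace ℂ H] [CompleteSpace H]

/-- The infinite matrix `((1 / 2π) ∫_X e^{i (n - m) x} dx)_{n, m}` is the matrix of one and only
one bounded operator. -/
theorem existsUnique_canonicalPhase (b : HilbertBasis ℕ ℂ H) (X : Set PhaseInterval) :
    ∃! T : H →L[ℂ] H, ∀ n m : ℕ, inner ℂ (b n) (T (b m)) = phaseEntry X n m := by
  classical
  have hO := orthonormal_phaseWave
  let J : H →L[ℂ] Lp ℂ 2 (volume : Measure PhaseInterval) :=
    (hO.orthogonalFamily.linearIsometry.comp b.repr.toLinearIsometry).toContinuousLinearMap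
  have hJ : ∀ n, J (b n) = (memLp_phaseWave n).toLp (phaseWave n) := by
    intro n
    change hO.orthogonalFamily.linearIsometry (b.repr (b n)) = _
    rw [b.repr_self, OrthogonalFamily.linearIsometry_apply_single]
    simp
  let R : H →L[ℂ] Lp ℂ 2 ((volume : Measure PhaseInterval).restrict X) :=
    (LpToLpRestrictCLM PhaseInterval ℂ ℂ volume 2 X).comp J
  have hR : ∀ n, R (b n) = ((memLp_phaseWave n).restrict X).toLp (phaseWave n) := by
    intro n
    refine Lp.ext ?_
    have h1 := LpToLpRestrictCLM_coeFn ℂ X (J (b n))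
    have h2 := ((memLp_phaseWave n).restrict X).coeFn_toLp
    have h3 : (J (b n) : PhaseInterval → ℂ) =ᵐ[volume.restrict X] phaseWave n := by
      rw [hJ]
      exact ae_restrict_of_ae (memLp_phaseWave n).coeFn_toLp
    exact h1.trans (h3.trans h2.symm)
  refine ⟨(ContinuousLinearMap.adjoint R).comp R, ?_, ?_⟩
  · intro n m
    rw [ContinuousLinearMap.comp_apply, ContinuousLinearMap.adjoint_inner_right, hR, hR,
      inner_phaseWave, phaseEntry]
  · have uniq : ∀ S T : H →L[ℂ] H,
        (∀ n m : ℕ, inner ℂ (b n) (S (b m)) = inner ℂ (b n) (T (b m))) → S = T := by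
      intro S T h
      refine ContinuousLinearMap.ext_on
        (Submodule.dense_iff_topologicalClosure_eq_top.2 b.dense_span) ?_
      rintro _ ⟨m, rfl⟩
      refine b.repr.injective ?_
      ext n
      simpa [HilbertBasis.repr_apply_apply] using h n m
    intro S hS
    refine uniq _ _ fun n m => ?_
    rw [hS, ContinuousLinearMap.comp_apply, ContinuousLinearMap.adjoint_inner_right, hR, hR,
      inner_phaseWave, phaseEntry]

end Construction

/-- The canonical phase `E_can(X) = ∑_{n,m} (1 / 2π) ∫_X e^{i (n - m) x} dx |n⟩⟨m|`: the bounded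
operator whose matrix elements `⟨n|E_can(X)|m⟩` in the number basis are
`(1 / 2π) ∫_X e^{i (n - m) x} dx`. -/
noncomputable def canonicalPhase {H : Type*} [NormedAddCommGroup H] [InnerProductSpace ℂ H]
    [CompleteSpace H] (b : HilbertBasis ℕ ℂ H) (X : Set PhaseInterval) : H →L[ℂ] H :=
  (existsUnique_canonicalPhase b X).choose

theorem inner_canonicalPhase {H : Type*} [NormedAddCommGroup H] [InnerProductSpace ℂ H]
    [CompleteSpace H] (b : HilbertBasis ℕ ℂ H) (X : Set PhaseInterval) (n m : ℕ) :
    inner ℂ (b n) (canonicalPhase b X (b m)) = phaseEntry X n m :=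
  (existsUnique_canonicalPhase b X).choose_spec.1 n m

/-- The probability `∑_{n ∈ S} |⟨φ|n⟩|²` that the number observable with eigenbasis `b` has its
value in the finite set `S` in the vector state `φ`. -/
noncomputable def numberProb {H : Type*} [NormedAddCommGroup H] [InnerProductSpace ℂ H]
    (b : HilbertBasis ℕ ℂ H) (S : Finset ℕ) (φ : H) : ℝ :=
  ∑ n ∈ S, ‖inner ℂ φ (b n)‖ ^ 2

/-- Probabilistic complementarity of the number observable with eigenbasis `b` and a phase
observable `E`. The inequalities for `⟨φ|E(X)φ⟩` are in the order of `ℂ` in which `z < w` means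
that `w - z` is real and positive. -/
def ProbabilisticallyComplementary {H : Type*} [NormedAddCommGroup H] [InnerProductSpace ℂ H]
    (b : HilbertBasis ℕ ℂ H) (E : Set PhaseInterval → H →L[ℂ] H) : Prop :=
  ∀ φ : H, ‖φ‖ = 1 → ∀ S : Finset ℕ, S.Nonempty →
    ∀ X : Set PhaseInterval, MeasurableSet X → E X ≠ 0 → E X ≠ ContinuousLinearMap.id ℂ H →
      (numberProb b S φ = 1 → 0 < inner ℂ φ (E X φ) ∧ inner ℂ φ (E X φ) < 1) ∧
      (inner ℂ φ (E X φ) = 1 → 0 < numberProb b S φ ∧ numberProb b S φ < 1)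

end NumberPhase

/-!
In the phase representation the number state `|n⟩` is the wave `e^{-inx} / √(2π)`, and
`⟨φ|E_can(X)φ⟩ = ∫_X |ψ|²`, where `ψ` is the wave function of `φ`. Up to complex conjugation `ψ` is
the boundary function of an element of the Hardy space `H²`, so it cannot vanish on a set of
positive measure unless `φ = 0`. If `E_can(X) ≠ 0` then `X` has positive measure, and if
`E_can(X) ≠ I` then so has its complement, since `E_can(Xᶜ) = I - E_can(X)`. Hence
`0 < ⟨φ|E_can(X)φ⟩ < 1` for *every* unit vector `φ` (`inner_canonicalPhase_pos`,
`inner_canonicalPhase_lt_one`). This gives the first implication for all `φ`, and it says that the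
premise `⟨φ|E_can(X)φ⟩ = 1` of the second is satisfied by no unit vector, so that this implication
rests entirely on the uniqueness theorem.

The uniqueness theorem for `H²` is proved with polynomials only. The partial sums
`P_k(z) = ∑_{n < k} ⟨φ|n⟩ zⁿ` satisfy `⟨φ_k|E_can(X)φ_k⟩ = (1 / 2π) ∫_X |P_k(e^{ix})|² dx`, where `φ_k`
is the `k`-th partial sum of `φ` in the number basis (`inner_canonicalPhase_sum`). All `P_k` with
`k > m` have the same lowest coefficient `⟨φ|m⟩ ≠ 0`, and the Mahler measure of a polynomial is at
least the modulus of its lowest coefficient (`norm_coeff_le_mahlerMeasure`), so the integral of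
`log |P_k|` over the circle is bounded below. If `⟨φ|E_can(Y)φ⟩ = 0` with `Y` of positive measure,
then `∫_Y |P_k|² → 0`; concavity of the logarithm drives the integral of `log |P_k|` over `Y` to
`-∞`, while the integral over the complement stays bounded above by the norm of `φ`, a contradiction
(`log_norm_coeff_le_setIntegral`, `re_inner_canonicalPhase_pos`).
-/

namespace NumberPhase

open Polynomial Filter Topology

/-! ### Polynomials on the unit circle -/

/-- A power of `X` has Mahler measure `1`, which reduces the claim to the constant coefficient of
the cofactor; there it follows from the product formula over the roots. -/
theorem norm_coeff_le_mahlerMeasure {p : ℂ[X]} {m : ℕ} (hp : ∀ d < m, p.coeff d = 0) :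
    ‖p.coeff m‖ ≤ p.mahlerMeasure := by
  obtain ⟨q, rfl⟩ := X_pow_dvd_iff.2 hp
  have hX : ((X : ℂ[X]) ^ m).mahlerMeasure = 1 := by
    rw [X_pow_eq_monomial, mahlerMeasure_def_of_ne_zero (by simp)]
    simp
  have hq : q.coeff 0 = (X ^ m * q).coeff m := by simp [coeff_X_pow_mul']
  rw [← hq, mahlerMeasure_mul, hX, one_mul, mahlerMeasure_eq_leadingCoeff_mul_prod_roots,
    (IsAlgClosed.splits q).coeff_zero_eq_leadingCoeff_mul_prod_roots, norm_mul, norm_mul, norm_pow,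
    norm_neg, norm_one, one_pow, one_mul]
  gcongr
  generalize q.roots = r
  induction r using Multiset.induction_on with
  | empty => simp
  | cons a r ih =>
    simp only [Multiset.prod_cons, Multiset.map_cons, norm_mul]
    gcongr
    exact le_max_right _ _

theorem ae_eval_exp_ne_zero {p : ℂ[X]} (hp : p ≠ 0) :
    ∀ᵐ x : PhaseInterval, p.eval (Complex.exp ((x : ℝ) * Complex.I)) ≠ 0 := by
  have hinj : Function.Injective fun x : PhaseInterval => Complex.exp ((x : ℝ) * Complex.I) := by
    intro x y hxy
    have h := Complex.exp_eq_exp_iff_exists_int.1 hxy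
    obtain ⟨n, hn⟩ := h
    have h1 : (x : ℝ) = y + n * (2 * Real.pi) := by
      have := congrArg Complex.im hn
      simpa using this
    have hx := x.2
    have hy := y.2
    have hpi := Real.pi_pos
    simp only [Set.mem_Ico] at hx hy
    have hn1 : (n : ℝ) < 1 := by nlinarith
    have hn2 : (-1 : ℝ) < n := by nlinarith
    have hn0 : n = 0 := by
      have : n < 1 := by exact_mod_cast hn1
      have : -1 < n := by exact_mod_cast hn2
      omega
    exact Subtype.ext (by simpa [hn0] using h1)
  have hfin : {x : PhaseInterval | p.eval (Complex.exp ((x : ℝ) * Complex.I)) = 0}.Finite :=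
    ((finite_setOfPred_isRoot hp).preimage hinj.injOn :)
  have himg : volume (Subtype.val ''
      {x : PhaseInterval | p.eval (Complex.exp ((x : ℝ) * Complex.I)) = 0}) = 0 :=
    (hfin.image _).measure_zero _
  rw [ae_iff]
  simp only [ne_eq, not_not]
  rwa [show (volume : Measure PhaseInterval) = Measure.comap Subtype.val volume from rfl,
    (MeasurableEmbedding.subtype_coe measurableSet_Ico).comap_apply]

theorem continuous_eval_exp (p : ℂ[X]) :
    Continuous fun x : PhaseInterval => p.eval (Complex.exp ((x : ℝ) * Complex.I)) := by
  have := p.continuous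
  fun_prop

theorem integrable_norm_eval_exp_sq (p : ℂ[X]) :
    Integrable fun x : PhaseInterval => ‖p.eval (Complex.exp ((x : ℝ) * Complex.I))‖ ^ 2 := by
  obtain ⟨C, hC⟩ := (isCompact_sphere (0 : ℂ) 1).exists_bound_of_continuousOn
    p.continuous.continuousOn
  refine Integrable.of_bound
    ((continuous_eval_exp p).norm.pow 2).aestronglyMeasurable (C ^ 2) (ae_of_all _ fun x => ?_)
  have h := hC (Complex.exp ((x : ℝ) * Complex.I)) (by simp [Complex.norm_exp])
  rw [norm_pow, norm_norm]
  gcongr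

theorem integrable_log_norm_eval_exp (p : ℂ[X]) :
    Integrable fun x : PhaseInterval => Real.log ‖p.eval (Complex.exp ((x : ℝ) * Complex.I))‖ := by
  have h := p.intervalIntegrable_mahlerMeasure
  rw [intervalIntegrable_iff_integrableOn_Ico_of_le (by positivity)] at h
  have hmap : Measure.map Subtype.val (volume : Measure PhaseInterval) =
      volume.restrict (Set.Ico 0 (2 * Real.pi)) := map_comap_subtype_coe measurableSet_Ico _
  rw [IntegrableOn, ← hmap,
    (MeasurableEmbedding.subtype_coe measurableSet_Ico).integrable_map_iff] at h
  simpa [Function.comp_def, circleMap] using h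

/-- Jensen's inequality for a polynomial on the unit circle. -/
theorem log_norm_coeff_le_integral {p : ℂ[X]} {m : ℕ} (hp : ∀ d < m, p.coeff d = 0)
    (hm : p.coeff m ≠ 0) :
    2 * Real.pi * Real.log ‖p.coeff m‖ ≤
      ∫ x : PhaseInterval, Real.log ‖p.eval (Complex.exp ((x : ℝ) * Complex.I))‖ := by
  have h := Real.log_le_log (norm_pos_iff.2 hm) (norm_coeff_le_mahlerMeasure hp)
  have hI : (∫ x : PhaseInterval, Real.log ‖p.eval (Complex.exp ((x : ℝ) * Complex.I))‖)
      = ∫ x in (0 : ℝ)..(2 * Real.pi), Real.log ‖p.eval (circleMap 0 1 x)‖ := by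
    rw [intervalIntegral.integral_of_le (by positivity), ← integral_Ico_eq_integral_Ioc]
    simpa [circleMap] using integral_subtype measurableSet_Ico
      (fun x : ℝ => Real.log ‖p.eval (circleMap 0 1 x)‖)
  rw [← logMahlerMeasure_eq_log_MahlerMeasure, logMahlerMeasure_def, Real.circleAverage_def,
    ← hI, smul_eq_mul] at h
  have hpi := Real.two_pi_pos
  calc _ ≤ 2 * Real.pi * ((2 * Real.pi)⁻¹ * _) := mul_le_mul_of_nonneg_left h hpi.le
    _ = _ := by rw [mul_inv_cancel_left₀ hpi.ne']

/-- The quantitative form of the uniqueness theorem: for fixed lowest coefficient and fixed `L²`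
norm, a polynomial cannot have a small `L²` norm on a set of positive measure, because the right
hand side tends to `-∞` as first the integral over `Y` and then `c` tend to `0`. -/
theorem log_norm_coeff_le_setIntegral {p : ℂ[X]} {m : ℕ} (hp : ∀ d < m, p.coeff d = 0)
    (hm : p.coeff m ≠ 0) {Y : Set PhaseInterval} (hY : MeasurableSet Y) {c : ℝ} (hc : 0 < c) :
    4 * Real.pi * Real.log ‖p.coeff m‖ ≤
      (∫ x in Y, ‖p.eval (Complex.exp ((x : ℝ) * Complex.I))‖ ^ 2) / c
        + volume.real Y * (Real.log c - 1)
        + ∫ x : PhaseInterval, ‖p.eval (Complex.exp ((x : ℝ) * Complex.I))‖ ^ 2 := by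
  have hp0 : p ≠ 0 := by
    rintro rfl
    simp at hm
  have hsq := integrable_norm_eval_exp_sq p
  have hind : Integrable (Y.indicator fun x : PhaseInterval =>
      ‖p.eval (Complex.exp ((x : ℝ) * Complex.I))‖ ^ 2 / c + (Real.log c - 1)) :=
    ((hsq.div_const c).add (integrable_const _)).indicator hY
  have key : ∀ᵐ x : PhaseInterval,
      2 * Real.log ‖p.eval (Complex.exp ((x : ℝ) * Complex.I))‖ ≤
        Y.indicator (fun x : PhaseInterval =>
          ‖p.eval (Complex.exp ((x : ℝ) * Complex.I))‖ ^ 2 / c + (Real.log c - 1)) x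
        + ‖p.eval (Complex.exp ((x : ℝ) * Complex.I))‖ ^ 2 := by
    filter_upwards [ae_eval_exp_ne_zero hp0] with x hx
    set t := ‖p.eval (Complex.exp ((x : ℝ) * Complex.I))‖
    have ht : 0 < t ^ 2 := pow_pos (norm_pos_iff.2 hx) 2
    have hlog : 2 * Real.log t = Real.log (t ^ 2) := by simp
    rw [hlog]
    by_cases hxY : x ∈ Y
    · rw [Set.indicator_of_mem hxY]
      -- `log s ≤ s / c + log c - 1` is the tangent line of the logarithm at `c`.
      have h := Real.log_le_sub_one_of_pos (div_pos ht hc)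
      rw [Real.log_div ht.ne' hc.ne'] at h
      change _ ≤ t ^ 2 / c + _ + _
      linarith
    · rw [Set.indicator_of_notMem hxY]
      linarith [Real.log_le_sub_one_of_pos ht]
  have h := integral_mono_ae ((integrable_log_norm_eval_exp p).const_mul 2) (hind.add hsq) key
  simp only [Pi.add_apply] at h
  rw [integral_const_mul, integral_add hind hsq, integral_indicator hY,
    integral_add (hsq.div_const c).integrableOn (integrable_const _), integral_div,
    setIntegral_const, smul_eq_mul] at h
  linarith [log_norm_coeff_le_integral hp hm]

/-! ### The canonical phase -/

section Operator

variable {H : Type*} [NormedAddCommGroup H] [InnerProductSpace ℂ H] [CompleteSpace H]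
  (b : HilbertBasis ℕ ℂ H)

theorem canonicalPhase_eq {X : Set PhaseInterval} {T : H →L[ℂ] H}
    (hT : ∀ n m : ℕ, inner ℂ (b n) (T (b m)) = phaseEntry X n m) : canonicalPhase b X = T :=
  (existsUnique_canonicalPhase b X).unique (inner_canonicalPhase b X) hT

theorem canonicalPhase_univ : canonicalPhase b Set.univ = ContinuousLinearMap.id ℂ H :=
  canonicalPhase_eq b fun n m => by
    simp [phaseEntry_univ, orthonormal_iff_ite.1 b.orthonormal]

theorem integrable_exp_phase (n m : ℕ) : Integrable fun x : PhaseInterval =>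
    Complex.exp (Complex.I * ((n : ℂ) - (m : ℂ)) * ((x : ℝ) : ℂ)) := by
  refine Integrable.of_bound (Continuous.aestronglyMeasurable (by fun_prop)) 1
    (ae_of_all _ fun x => ?_)
  simp [Complex.norm_exp]

theorem canonicalPhase_add_compl {X : Set PhaseInterval} (hX : MeasurableSet X) :
    canonicalPhase b X + canonicalPhase b Xᶜ = ContinuousLinearMap.id ℂ H := by
  rw [← canonicalPhase_univ b]
  refine (canonicalPhase_eq b fun n m => ?_).symm
  rw [add_apply, inner_add_right, inner_canonicalPhase, inner_canonicalPhase,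
    phaseEntry, phaseEntry, ← mul_add, integral_add_compl hX (integrable_exp_phase n m),
    phaseEntry, Measure.restrict_univ]

theorem canonicalPhase_eq_zero {X : Set PhaseInterval} (hX : volume X = 0) :
    canonicalPhase b X = 0 :=
  canonicalPhase_eq b fun n m => by simp [phaseEntry, Measure.restrict_eq_zero.2 hX]

/-- On finite superpositions of number states the phase probability is an integral of the squared
modulus of a polynomial on the unit circle. -/
theorem inner_canonicalPhase_sum (X : Set PhaseInterval) (a : ℕ → ℂ) (k : ℕ) :
    inner ℂ (∑ n ∈ Finset.range k, starRingEnd ℂ (a n) • b n)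
        (canonicalPhase b X (∑ n ∈ Finset.range k, starRingEnd ℂ (a n) • b n)) =
      (((2 * Real.pi)⁻¹ * ∫ x in X, ‖(∑ n ∈ Finset.range k, monomial n (a n)).eval
        (Complex.exp ((x : ℝ) * Complex.I))‖ ^ 2 : ℝ) : ℂ) := by
  have hpt : ∀ x : PhaseInterval, ((‖(∑ n ∈ Finset.range k, monomial n (a n)).eval
        (Complex.exp ((x : ℝ) * Complex.I))‖ ^ 2 : ℝ) : ℂ) =
      ∑ n ∈ Finset.range k, ∑ m ∈ Finset.range k, a n * starRingEnd ℂ (a m) *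
        Complex.exp (Complex.I * ((n : ℂ) - (m : ℂ)) * ((x : ℝ) : ℂ)) := by
    intro x
    rw [Complex.ofReal_pow, ← Complex.mul_conj', eval_finsetSum, map_sum, Finset.sum_mul_sum]
    refine Finset.sum_congr rfl fun n _ => Finset.sum_congr rfl fun m _ => ?_
    have he : Complex.exp (Complex.I * ((n : ℂ) - (m : ℂ)) * ((x : ℝ) : ℂ)) =
        Complex.exp ((x : ℝ) * Complex.I) ^ n *
          starRingEnd ℂ (Complex.exp ((x : ℝ) * Complex.I) ^ m) := by
      rw [map_pow, ← Complex.exp_conj, ← Complex.exp_nat_mul, ← Complex.exp_nat_mul,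
        ← Complex.exp_add]
      congr 1
      simp
      ring
    rw [he, eval_monomial, eval_monomial, map_mul]
    ring
  rw [Complex.ofReal_mul, ← integral_complex_ofReal]
  simp_rw [hpt]
  rw [integral_finsetSum _ fun n _ => integrable_finsetSum _ fun m _ =>
    ((integrable_exp_phase n m).const_mul _).integrableOn, sum_inner, Finset.mul_sum]
  refine Finset.sum_congr rfl fun n _ => ?_
  rw [integral_finsetSum _ fun m _ => ((integrable_exp_phase n m).const_mul _).integrableOn,
    map_sum, inner_sum, Finset.mul_sum]
  refine Finset.sum_congr rfl fun m _ => ?_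
  rw [map_smul, inner_smul_left, inner_smul_right, inner_canonicalPhase, phaseEntry,
    integral_const_mul, Complex.conj_conj]
  push_cast
  ring

theorem tendsto_inner_canonicalPhase_sum (X : Set PhaseInterval) (φ : H) :
    Tendsto (fun k => (((2 * Real.pi)⁻¹ * ∫ x in X,
        ‖(∑ n ∈ Finset.range k, monomial n (inner ℂ φ (b n))).eval
          (Complex.exp ((x : ℝ) * Complex.I))‖ ^ 2 : ℝ) : ℂ))
      atTop (𝓝 (inner ℂ φ (canonicalPhase b X φ))) := by
  have h : Tendsto (fun k => ∑ n ∈ Finset.range k, starRingEnd ℂ (inner ℂ φ (b n)) • b n)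
      atTop (𝓝 φ) := by
    simpa [b.repr_apply_apply] using (b.hasSum_repr φ).tendsto_sum_nat
  refine (h.inner (((canonicalPhase b X).continuous.tendsto φ).comp h)).congr fun k => ?_
  rw [Function.comp_apply, inner_canonicalPhase_sum]

theorem tendsto_re_inner_canonicalPhase_sum (X : Set PhaseInterval) (φ : H) :
    Tendsto (fun k => (2 * Real.pi)⁻¹ * ∫ x in X,
        ‖(∑ n ∈ Finset.range k, monomial n (inner ℂ φ (b n))).eval
          (Complex.exp ((x : ℝ) * Complex.I))‖ ^ 2)
      atTop (𝓝 (inner ℂ φ (canonicalPhase b X φ)).re) :=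
  (Complex.continuous_re.tendsto _).comp (tendsto_inner_canonicalPhase_sum b X φ)

theorem inner_canonicalPhase_im (X : Set PhaseInterval) (φ : H) :
    (inner ℂ φ (canonicalPhase b X φ)).im = 0 :=
  tendsto_nhds_unique
    ((Complex.continuous_im.tendsto _).comp (tendsto_inner_canonicalPhase_sum b X φ))
    (tendsto_const_nhds.congr fun _ => (Complex.ofReal_im _).symm)

/-- If the expectation vanished, the partial sums of `φ` would tend to `0` in `L²(Y)` with their
lowest nonzero coefficient fixed and their norms bounded by that of `φ`, which
`log_norm_coeff_le_setIntegral` excludes. -/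
theorem re_inner_canonicalPhase_pos {Y : Set PhaseInterval} (hY : MeasurableSet Y)
    (hvol : volume Y ≠ 0) {φ : H} (hφ : φ ≠ 0) :
    0 < (inner ℂ φ (canonicalPhase b Y φ)).re := by
  have hpi := Real.two_pi_pos
  have hT := tendsto_re_inner_canonicalPhase_sum b Y φ
  have hnonneg : 0 ≤ (inner ℂ φ (canonicalPhase b Y φ)).re :=
    ge_of_tendsto' hT fun k => by positivity
  refine hnonneg.lt_of_ne' fun hzero => ?_
  rw [hzero] at hT
  have hU := tendsto_re_inner_canonicalPhase_sum b Set.univ φ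
  rw [canonicalPhase_univ] at hU
  simp only [Measure.restrict_univ, ContinuousLinearMap.id_apply] at hU
  set A : ℝ := (inner ℂ φ φ : ℂ).re
  have hex : ∃ n, inner ℂ φ (b n) ≠ 0 := by
    by_contra! hall
    refine hφ (b.repr.injective ?_)
    ext n
    rw [b.repr_apply_apply, ← inner_conj_symm, hall]
    simp
  obtain ⟨m, hm, hmin⟩ : ∃ m, inner ℂ φ (b m) ≠ 0 ∧ ∀ d < m, inner ℂ φ (b d) = 0 :=
    ⟨Nat.find hex, Nat.find_spec hex, fun d hd => not_not.1 (Nat.find_min hex hd)⟩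
  have hV : 0 < volume.real Y := ENNReal.toReal_pos hvol (measure_ne_top _ _)
  have hbound : ∀ c : ℝ, 0 < c → 4 * Real.pi * Real.log ‖(inner ℂ φ (b m) : ℂ)‖ ≤
      volume.real Y * (Real.log c - 1) + 2 * Real.pi * A := by
    intro c hc
    have hlim := (((hT.const_mul (2 * Real.pi)).div_const c).add_const
      (volume.real Y * (Real.log c - 1))).add (hU.const_mul (2 * Real.pi))
    rw [mul_zero, zero_div, zero_add] at hlim
    refine ge_of_tendsto hlim ?_
    filter_upwards [eventually_gt_atTop m] with k hk
    have hcoeff : ∀ d ≤ m, (∑ n ∈ Finset.range k, monomial n (inner ℂ φ (b n) : ℂ)).coeff d =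
        inner ℂ φ (b d) := by
      intro d hd
      simp only [finsetSum_coeff, coeff_monomial, Finset.sum_ite_eq', Finset.mem_range]
      rw [if_pos (hd.trans_lt hk)]
    have h := log_norm_coeff_le_setIntegral (m := m)
      (fun d hd => (hcoeff d hd.le).trans (hmin d hd)) (by rwa [hcoeff m le_rfl]) hY hc
    rwa [hcoeff m le_rfl, ← mul_inv_cancel_left₀ hpi.ne' (∫ x in Y, _),
      ← mul_inv_cancel_left₀ hpi.ne' (∫ x : PhaseInterval, _)] at h
  -- For this `c` the right hand side of `hbound` is the left hand side minus `1`.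
  have h := hbound (Real.exp ((4 * Real.pi * Real.log ‖(inner ℂ φ (b m) : ℂ)‖ - 2 * Real.pi * A
    - 1) / volume.real Y + 1)) (Real.exp_pos _)
  rw [Real.log_exp, add_sub_cancel_right, mul_div_cancel₀ _ hV.ne'] at h
  linarith

theorem inner_canonicalPhase_pos {Y : Set PhaseInterval} (hY : MeasurableSet Y)
    (hE : canonicalPhase b Y ≠ 0) {φ : H} (hφ : φ ≠ 0) :
    0 < inner ℂ φ (canonicalPhase b Y φ) :=
  Complex.pos_iff.2 ⟨re_inner_canonicalPhase_pos b hY (fun h => hE (canonicalPhase_eq_zero b h)) hφ,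
    (inner_canonicalPhase_im b Y φ).symm⟩

theorem inner_canonicalPhase_lt_one {X : Set PhaseInterval} (hX : MeasurableSet X)
    (hE : canonicalPhase b X ≠ ContinuousLinearMap.id ℂ H) {φ : H} (hφ : ‖φ‖ = 1) :
    inner ℂ φ (canonicalPhase b X φ) < 1 := by
  have hadd := canonicalPhase_add_compl b hX
  have hpos : 0 < inner ℂ φ (canonicalPhase b Xᶜ φ) := by
    refine inner_canonicalPhase_pos b hX.compl (fun h => hE ?_) (by
      rintro rfl
      simp at hφ)
    rwa [h, add_zero] at hadd
  have hsum : inner ℂ φ (canonicalPhase b X φ) + inner ℂ φ (canonicalPhase b Xᶜ φ) = 1 := by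
    rw [← inner_add_right, ← add_apply, hadd, ContinuousLinearMap.id_apply,
      inner_self_eq_norm_sq_to_K, hφ]
    simp
  rw [← hsum]
  exact lt_add_of_pos_right _ hpos

end Operator

end NumberPhase

theorem mainTheorem10 {H : Type*} [NormedAddCommGroup H] [InnerProductSpace ℂ H]
    [CompleteSpace H] (b : HilbertBasis ℕ ℂ H) :
    NumberPhase.ProbabilisticallyComplementary b (NumberPhase.canonicalPhase b) := by
  intro φ hφ S _ X hX h0 hI
  have hφ0 : φ ≠ 0 := by
    rintro rfl
    simp at hφ
  have hlt := NumberPhase.inner_canonicalPhase_lt_one b hX hI hφ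
  exact ⟨fun _ => ⟨NumberPhase.inner_canonicalPhase_pos b hX h0 hφ0, hlt⟩,
    fun h => absurd h hlt.ne⟩
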